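/- Let $\mathcal H$ be a complex Hilbert space with a Hilbert basis $\{|n\rangle\}_{n\in\mathbb Z}$ (so $\mathcal H$ is infinite-dimensional and separable). Let $\mathfrak u(\mathcal H)$ be the real Banach Lie algebra of bounded skew-Hermitian operators on $\mathcal H$, with the operator norm and the commutator bracket, and let $\mathfrak u(\mathcal H)^*$ be its continuous dual. The coadjoint action of $A\in\mathfrak u(\mathcal H)$ on $\varphi\in\mathfrak u(\mathcal H)^*$ is $(\mathrm{ad}^*_A\varphi)(X)=\varphi([A,X])$. Let $$\mathfrak b_1^+(\mathcal H)=\{B\in L_1(\mathcal H):\ B|n\rangle\in\overline{\mathrm{span}}\{|m\rangle: m\ge n\}\ \text{and}\ \langle n|B|n\rangle\in\mathbb R\ \text{for all } n\in\mathbb Z\},$$ where $L_1(\mathcal H)$ is the space of trace-class operators with the trace norm $\|B\|_1=\operatorname{Tr}|B|$. Identify $\mathfrak b_1^+(\mathcal H)$ with its image in $\mathfrak u(\mathcal H)^*$ under the injective map $B\mapsto\varphi_B$, $\varphi_B(X)=\operatorname{Im}\operatorname{Tr}(XB)$, and give this image the norm $\|\varphi_B\|:=\|B\|_1$. Then the coadjoint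 action of $\mathfrak u(\mathcal H)$ on the image of $\mathfrak b_1^+(\mathcal H)$ in $\mathfrak u(\mathcal H)^*$ is unbounded: there is an $A\in\mathfrak u(\mathcal H)$ such that for every $M\ge 0$ there are $B,C\in\mathfrak b_1^+(\mathcal H)$ with $$\mathrm{ad}^*_A\varphi_B=\varphi_C,\qquad \|B\|_1\le 1,\qquad \|C\|_1>M .$$ -/

import Mathlib

open scoped InnerProductSpace ENNReal NNReal

noncomputable section

namespace UnitaryCoadjoint

variable {H : Type*} [NormedAddCommGroup H] [InnerProductSpace ℂ H] [CompleteSpace H]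

/-- The real Banach Lie algebra `𝔲(H)` of bounded skew-Hermitian operators on `H`
(with the operator norm). -/
abbrev u (H : Type*) [NormedAddCommGroup H] [InnerProductSpace ℂ H] [CompleteSpace H] :
    Submodule ℝ (H →L[ℂ] H) :=
  skewAdjoint.submodule ℝ (H →L[ℂ] H)

theorem commutator_mem_u (A X : u H) :
    (A : H →L[ℂ] H) * X - (X : H →L[ℂ] H) * A ∈ u H := by
  have hA : star (A : H →L[ℂ] H) = -A := skewAdjoint.mem_iff.1 A.2
  have hX : star (X : H →L[ℂ] H) = -X := skewAdjoint.mem_iff.1 X.2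
  refine skewAdjoint.mem_iff.2 ?_
  rw [star_sub, star_mul, star_mul, hA, hX]
  noncomm_ring

/-- The adjoint action `ad_A : 𝔲(H) → 𝔲(H)`, `X ↦ [A, X] = A X - X A`. -/
def ad (A : u H) : u H →L[ℝ] u H :=
  ((ContinuousLinearMap.mul ℝ (H →L[ℂ] H) A
      - (ContinuousLinearMap.mul ℝ (H →L[ℂ] H)).flip A).comp (u H).subtypeL).codRestrict
    (u H) (commutator_mem_u A)

@[simp] theorem coe_ad_apply (A X : u H) :
    ((ad A X : u H) : H →L[ℂ] H) = (A : H →L[ℂ] H) * X - (X : H →L[ℂ] H) * A := rfl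

/-- The coadjoint action of `A ∈ 𝔲(H)` on the continuous dual `𝔲(H)^*`:
`(ad^*_A φ)(X) = φ([A, X])`. -/
def coad (A : u H) (φ : StrongDual ℝ (u H)) : StrongDual ℝ (u H) :=
  φ.comp (ad A)

/-- The trace norm `‖T‖₁ = Tr |T| = ∑ₙ ⟨n| |T| |n⟩`, `|T| = (T^* T)^{1/2}`, with value `∞` when
`T` is not of trace class. It does not depend on the Hilbert basis `e`. -/
def traceNorm {ι : Type*} (e : HilbertBasis ι ℂ H) (T : H →L[ℂ] H) : ℝ≥0∞ :=
  ∑' n, ENNReal.ofReal (RCLike.re ⟪e n, CFC.abs T (e n)⟫_ℂ)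

/-- `T` belongs to the trace class `L₁(H)`. -/
def IsTraceClass {ι : Type*} (e : HilbertBasis ι ℂ H) (T : H →L[ℂ] H) : Prop :=
  traceNorm e T < ∞

/-- The trace `Tr T = ∑ₙ ⟨n| T |n⟩`; only used for trace-class `T`, where the series converges
absolutely and the sum does not depend on the Hilbert basis `e`. -/
def trace {ι : Type*} (e : HilbertBasis ι ℂ H) (T : H →L[ℂ] H) : ℂ :=
  ∑' n, ⟪e n, T (e n)⟫_ℂ

/-- `𝔟₁⁺(H)`: the trace-class operators `B` with `B |n⟩` in the closed span of
`{|m⟩ : m ≥ n}` and `⟨n|B|n⟩` real, for all `n : ℤ`. -/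
def bPlus (e : HilbertBasis ℤ ℂ H) : Set (H →L[ℂ] H) :=
  {B | IsTraceClass e B ∧
    ∀ n : ℤ, B (e n) ∈ (Submodule.span ℂ (e '' Set.Ici n)).topologicalClosure ∧
      (⟪e n, B (e n)⟫_ℂ).im = 0}

/-- `φ ∈ 𝔲(H)^*` is the functional `X ↦ Im Tr (X B)`. -/
def Represents (e : HilbertBasis ℤ ℂ H) (B : H →L[ℂ] H) (φ : StrongDual ℝ (u H)) : Prop :=
  ∀ X : u H, φ X = (trace e ((X : H →L[ℂ] H) * B)).im

/-- The image of `𝔟₁⁺(H)` in `𝔲(H)^*` under `B ↦ (X ↦ Im Tr (X B))`. -/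
def bPlusImage (e : HilbertBasis ℤ ℂ H) : Set (StrongDual ℝ (u H)) :=
  {φ | ∃ B ∈ bPlus e, Represents e B φ}

/-- The norm on the image of `𝔟₁⁺(H)` transported from the trace norm of `𝔟₁⁺(H)`. The map
`B ↦ (X ↦ Im Tr (X B))` is injective on `𝔟₁⁺(H)`, so that on the image the infimum runs over a
single operator; outside the image the value is `∞`. -/
def imageNorm (e : HilbertBasis ℤ ℂ H) (φ : StrongDual ℝ (u H)) : ℝ≥0∞ :=
  ⨅ B ∈ {B | B ∈ bPlus e ∧ Represents e B φ}, traceNorm e B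

end UnitaryCoadjoint

end

/-!
Let `x_N`, `y_N` (`N : ℕ`) be mutually orthogonal orthonormal sequences, where `x_N = |-(N+1)⟩` and
`y_N` is the normalized sum of the `L = 2^N` basis vectors in the window `{2^N, …, 2^(N+1) - 1}`. A
single bounded skew-Hermitian `A` satisfies `A x_N = y_N` and `A y_N = -x_N` for all `N`
(`exists_skew`). The operator `B = |y_N⟩⟨x_N|` lies in `𝔟₁⁺(H)` and has trace norm `1`, and
`ad^*_A φ_B` is the functional of the Hermitian operator `[B, A] = |x_N⟩⟨x_N| - |y_N⟩⟨y_N|`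
(`coad_imInner`). Its representative `C` in `𝔟₁⁺(H)` is obtained by keeping the diagonal,
doubling the entries below it and dropping those above it (`represents_truncation`); by
`Represents.ext` there is no other. Thus the unboundedness of the coadjoint action comes down to the
unboundedness of triangular truncation in the trace norm, even on rank-one projections.

To see the latter, the trace norm of `C` is bounded below by the sum of the `|⟨f_j, C f_j⟩|` over the
discrete Fourier vectors `f_j` of the window (`sum_norm_inner_le_traceNorm`). These numbers are
`|ω^j + 1| / (L |ω^j - 1|)` with `ω = exp (2πi/L)` (`inner_windowVec_truncation`), so their sum
is at least a multiple of the harmonic sum `∑ 1/j`, and `‖C‖₁ ≥ log L / π - 1`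
(`log_le_traceNorm_rankOne_sub_truncation`).
-/

open InnerProductSpace ContinuousLinearMap

noncomputable section

namespace UnitaryCoadjoint

section NormedSpace

variable {H : Type*} [NormedAddCommGroup H] [InnerProductSpace ℂ H]

/-! ### Traces of rank-one operators -/

theorem hasSum_inner_rankOne {ι : Type*} (e : HilbertBasis ι ℂ H) (v w : H) :
    HasSum (fun n => ⟪e n, rankOne ℂ v w (e n)⟫_ℂ) ⟪w, v⟫_ℂ := by
  simpa [inner_smul_right] using e.hasSum_inner_mul_inner w v

theorem hasSum_inner_mul_rankOne {ι : Type*} (e : HilbertBasis ι ℂ H) (X : H →L[ℂ] H) (v w : H) :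
    HasSum (fun n => ⟪e n, (X * rankOne ℂ v w) (e n)⟫_ℂ) ⟪w, X v⟫_ℂ := by
  have : X * rankOne ℂ v w = rankOne ℂ (X v) w := by
    ext x
    simp
  rw [this]
  exact hasSum_inner_rankOne e _ _

/-! ### Triangular truncation on a finite window -/

/-- The vector `L^{-1/2} ∑_{i<L} ζ^i |s+i⟩` on the window `{s, …, s+L-1}`. For the `L`-th roots of
unity `ζ` these are the discrete Fourier vectors of the window. -/
def windowVec (e : HilbertBasis ℤ ℂ H) (s : ℤ) (L : ℕ) (ζ : ℂ) : H :=
  ((√(L : ℝ) : ℝ) : ℂ)⁻¹ • ∑ i ∈ Finset.range L, ζ ^ i • e (s + i)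

/-- The column of index `s + i` of `truncation e s L`: the vector
`L⁻¹ (|s+i⟩ + 2 ∑_{i<l<L} |s+l⟩)`. -/
def truncCol (e : HilbertBasis ℤ ℂ H) (s : ℤ) (L i : ℕ) : H :=
  (L : ℂ)⁻¹ • (e (s + i) + (2 : ℂ) • ∑ l ∈ Finset.Ico (i + 1) L, e (s + l))

/-- With `a = windowVec e s L 1`, so that all entries of `|a⟩⟨a|` on the window are `1/L`, this is
the operator with entries `1/L` on the diagonal, `2/L` below it and `0` above it. -/
def truncation (e : HilbertBasis ℤ ℂ H) (s : ℤ) (L : ℕ) : H →L[ℂ] H :=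
  ∑ i ∈ Finset.range L, rankOne ℂ (truncCol e s L i) (e (s + i))

variable (e : HilbertBasis ℤ ℂ H) (s : ℤ) (L : ℕ)

theorem inner_basis_add (i l : ℕ) : ⟪e (s + i), e (s + l)⟫_ℂ = if i = l then 1 else 0 := by
  rw [orthonormal_iff_ite.1 e.orthonormal]
  simp

theorem inner_windowVec_basis (ζ : ℂ) {l : ℕ} (hl : l < L) :
    ⟪windowVec e s L ζ, e (s + l)⟫_ℂ = ((√(L : ℝ) : ℝ) : ℂ)⁻¹ * (starRingEnd ℂ ζ) ^ l := by
  simp [windowVec, inner_basis_add, hl, mul_comm]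

theorem inner_basis_windowVec_of_lt (ζ : ℂ) {k : ℤ} (hk : k < s) :
    ⟪e k, windowVec e s L ζ⟫_ℂ = 0 := by
  rw [windowVec, inner_smul_right, inner_sum, Finset.sum_eq_zero, mul_zero]
  intro i _
  rw [inner_smul_right, e.orthonormal.2 (by lia), mul_zero]

theorem inv_sqrt_mul_inv_sqrt : ((√(L : ℝ) : ℝ) : ℂ)⁻¹ * ((√(L : ℝ) : ℝ) : ℂ)⁻¹ = (L : ℂ)⁻¹ := by
  rw [← mul_inv, ← Complex.ofReal_mul, Real.mul_self_sqrt (Nat.cast_nonneg L)]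
  simp

theorem inner_windowVec (ζ ξ : ℂ) : ⟪windowVec e s L ζ, windowVec e s L ξ⟫_ℂ =
    (L : ℂ)⁻¹ * ∑ i ∈ Finset.range L, (starRingEnd ℂ ζ * ξ) ^ i := by
  conv_lhs => rw [windowVec.eq_def e s L ξ]
  rw [inner_smul_right, inner_sum, ← inv_sqrt_mul_inv_sqrt, mul_assoc]
  congr 1
  rw [Finset.mul_sum]
  refine Finset.sum_congr rfl fun i hi => ?_
  rw [inner_smul_right, inner_windowVec_basis e s L ζ (Finset.mem_range.1 hi), mul_pow]
  ring

theorem orthonormal_windowVec {L : ℕ} (hL : L ≠ 0) {ω : ℂ} (hω : IsPrimitiveRoot ω L) :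
    Orthonormal ℂ fun j : Fin L => windowVec e s L (ω ^ (j : ℕ)) := by
  have hL' : (L : ℂ) ≠ 0 := Nat.cast_ne_zero.2 hL
  have hconj : starRingEnd ℂ ω = ω⁻¹ := (Complex.inv_eq_conj (hω.norm'_eq_one hL)).symm
  have h0 : ω ≠ 0 := hω.ne_zero hL
  rw [orthonormal_iff_ite]
  intro i j
  rw [inner_windowVec, map_pow, hconj]
  split_ifs with h
  · subst h
    simp [h0, hL']
  · have h1 : ω⁻¹ ^ (i : ℕ) * ω ^ (j : ℕ) ≠ 1 := by
      intro h2
      rw [inv_pow, inv_mul_eq_one₀ (pow_ne_zero _ h0)] at h2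
      exact h (Fin.ext (hω.pow_inj i.2 j.2 h2))
    rw [geom_sum_eq h1, mul_pow, pow_right_comm, pow_right_comm ω, inv_pow ω, hω.pow_eq_one]
    simp

theorem inner_windowVec_truncCol (ζ : ℂ) {i : ℕ} (hi : i < L) :
    ⟪windowVec e s L ζ, truncCol e s L i⟫_ℂ = ((√(L : ℝ) : ℝ) : ℂ)⁻¹ * (L : ℂ)⁻¹ *
      ((starRingEnd ℂ ζ) ^ i + 2 * ∑ l ∈ Finset.Ico (i + 1) L, (starRingEnd ℂ ζ) ^ l) := by
  have h : ∑ l ∈ Finset.Ico (i + 1) L, ⟪windowVec e s L ζ, e (s + l)⟫_ℂ =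
      ((√(L : ℝ) : ℝ) : ℂ)⁻¹ * ∑ l ∈ Finset.Ico (i + 1) L, (starRingEnd ℂ ζ) ^ l := by
    rw [Finset.mul_sum]
    exact Finset.sum_congr rfl fun l hl =>
      inner_windowVec_basis e s L ζ (Finset.mem_Ico.1 hl).2
  rw [truncCol, inner_smul_right, inner_add_right, inner_smul_right, inner_sum, h,
    inner_windowVec_basis e s L ζ hi]
  ring

theorem truncation_windowVec (ζ : ℂ) : truncation e s L (windowVec e s L ζ) =
    ((√(L : ℝ) : ℝ) : ℂ)⁻¹ • ∑ i ∈ Finset.range L, ζ ^ i • truncCol e s L i := by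
  rw [truncation, sum_apply, Finset.smul_sum]
  refine Finset.sum_congr rfl fun i hi => ?_
  rw [rankOne_apply, ← inner_conj_symm, inner_windowVec_basis e s L ζ (Finset.mem_range.1 hi)]
  simp [smul_smul]

/-- For `ζ = exp (iθ)` the value is `-(i/L) cot (θ/2)`: the diagonal of the truncation in the Fourier
vectors decays only like the inverse of the frequency. -/
theorem inner_windowVec_truncation {L : ℕ} (hL : L ≠ 0) {ζ : ℂ} (hζ : ζ ^ L = 1) (h1 : ζ ≠ 1) :
    ⟪windowVec e s L ζ, truncation e s L (windowVec e s L ζ)⟫_ℂ =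
      (L : ℂ)⁻¹ * ((ζ + 1) / (ζ - 1)) := by
  have hL' : (L : ℂ) ≠ 0 := Nat.cast_ne_zero.2 hL
  have hconj : starRingEnd ℂ ζ = ζ⁻¹ :=
    (Complex.inv_eq_conj (Complex.norm_eq_one_of_pow_eq_one hζ hL)).symm
  have h0 : ζ ≠ 0 := by
    rintro rfl
    simp [hL] at hζ
  have hz1 : ζ⁻¹ ≠ 1 := by simpa using h1
  have hsub : ζ - 1 ≠ 0 := sub_ne_zero.2 h1
  have hsub' : ζ⁻¹ - 1 ≠ 0 := sub_ne_zero.2 hz1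
  -- The inner geometric sum, multiplied by `ζ ^ i`, is a constant plus a multiple of `ζ ^ i`; the
  -- latter cancels in the sum over `i`.
  have hterm : ∀ i ∈ Finset.range L,
      ζ ^ i * (ζ⁻¹ ^ i + 2 * ∑ l ∈ Finset.Ico (i + 1) L, ζ⁻¹ ^ l) =
        (1 - 2 * ζ⁻¹ / (ζ⁻¹ - 1)) + 2 / (ζ⁻¹ - 1) * ζ ^ i := by
    intro i hi
    have hi' : ζ ^ i * ζ⁻¹ ^ i = 1 := by rw [← mul_pow, mul_inv_cancel₀ h0, one_pow]
    rw [geom_sum_Ico hz1 (Finset.mem_range.1 hi), inv_pow ζ L, hζ, inv_one, pow_succ]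
    clear hconj hz1 hsub'
    generalize ζ⁻¹ = w at hi' ⊢
    linear_combination (1 - 2 * w / (w - 1)) * hi'
  have hsum : ∑ i ∈ Finset.range L, ζ ^ i * ⟪windowVec e s L ζ, truncCol e s L i⟫_ℂ =
      ((√(L : ℝ) : ℝ) : ℂ)⁻¹ * ((ζ + 1) / (ζ - 1)) := by
    have : ∀ i ∈ Finset.range L, ζ ^ i * ⟪windowVec e s L ζ, truncCol e s L i⟫_ℂ =
        ((√(L : ℝ) : ℝ) : ℂ)⁻¹ * (L : ℂ)⁻¹ *
          ((1 - 2 * ζ⁻¹ / (ζ⁻¹ - 1)) + 2 / (ζ⁻¹ - 1) * ζ ^ i) := by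
      intro i hi
      rw [inner_windowVec_truncCol e s L ζ (Finset.mem_range.1 hi), hconj, ← hterm i hi]
      ring
    rw [Finset.sum_congr rfl this, ← Finset.mul_sum, Finset.sum_add_distrib, ← Finset.mul_sum,
      geom_sum_eq h1, hζ, sub_self, zero_div, mul_zero, add_zero, Finset.sum_const,
      Finset.card_range, nsmul_eq_mul, mul_assoc, inv_mul_cancel_left₀ hL']
    congr 1
    have : ζ⁻¹ - 1 = -(ζ - 1) / ζ := by field_simp; ring
    rw [this]
    field_simp
    ring
  rw [truncation_windowVec, inner_smul_right, inner_sum]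
  simp only [inner_smul_right]
  rw [hsum, ← mul_assoc, inv_sqrt_mul_inv_sqrt]

/-- The logarithmic divergence: for `0 < j < L` and `ζ = exp (2πij/L)` one has
`‖ζ - 1‖ ≤ 2πj/L`, so the `j`-th term is at least `1/(πj) - 1/L`. -/
theorem log_le_sum_norm_inner_truncation {L : ℕ} (hL : L ≠ 0) :
    Real.log L / Real.pi - 1 ≤ ∑ j : Fin L,
      ‖⟪windowVec e s L (Complex.exp (2 * Real.pi * Complex.I / L) ^ (j : ℕ)),
        truncation e s L
          (windowVec e s L (Complex.exp (2 * Real.pi * Complex.I / L) ^ (j : ℕ)))⟫_ℂ‖ := by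
  have hω := Complex.isPrimitiveRoot_exp L hL
  set ω := Complex.exp (2 * Real.pi * Complex.I / L) with hωdef
  obtain ⟨n, rfl⟩ := Nat.exists_eq_succ_of_ne_zero hL
  have hLpos : (0 : ℝ) < (n + 1 : ℕ) := by positivity
  have hterm : ∀ j ∈ Finset.range n, Real.pi⁻¹ * ((j + 1 : ℕ) : ℝ)⁻¹ - ((n + 1 : ℕ) : ℝ)⁻¹ ≤
      ‖⟪windowVec e s (n + 1) (ω ^ (j + 1)),
        truncation e s (n + 1) (windowVec e s (n + 1) (ω ^ (j + 1)))⟫_ℂ‖ := by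
    intro j hj
    have hj' : j + 1 < n + 1 := by simpa using hj
    have hζ : (ω ^ (j + 1)) ^ (n + 1) = 1 := by
      rw [← pow_mul, mul_comm, pow_mul, hω.pow_eq_one, one_pow]
    have hζ1 : ω ^ (j + 1) ≠ 1 := hω.pow_ne_one_of_pos_of_lt (by lia) hj'
    have hdist : ‖ω ^ (j + 1) - 1‖ ≤ 2 * Real.pi * (j + 1 : ℕ) / (n + 1 : ℕ) := by
      have h1 : ω ^ (j + 1) =
          Complex.exp (Complex.I * (2 * Real.pi * (j + 1 : ℕ) / (n + 1 : ℕ) : ℝ)) := by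
        rw [hωdef, ← Complex.exp_nat_mul]
        congr 1
        push_cast
        ring
      rw [h1]
      refine Real.norm_exp_I_mul_ofReal_sub_one_le.trans_eq ?_
      exact Real.norm_of_nonneg (by positivity)
    rw [inner_windowVec_truncation e s hL hζ hζ1, norm_mul, norm_div, norm_inv,
      Complex.norm_natCast]
    set ζ := ω ^ (j + 1)
    have hpos : 0 < ‖ζ - 1‖ := norm_pos_iff.2 (sub_ne_zero.2 hζ1)
    -- From `(ζ + 1) - (ζ - 1) = 2`.
    have h2 : 2 - ‖ζ - 1‖ ≤ ‖ζ + 1‖ := by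
      have h3 := norm_sub_le (ζ + 1) (ζ - 1)
      have h4 : ζ + 1 - (ζ - 1) = 2 := by ring
      rw [h4, Complex.norm_ofNat] at h3
      linarith
    calc Real.pi⁻¹ * ((j + 1 : ℕ) : ℝ)⁻¹ - ((n + 1 : ℕ) : ℝ)⁻¹
        = ((n + 1 : ℕ) : ℝ)⁻¹ * (2 / (2 * Real.pi * (j + 1 : ℕ) / (n + 1 : ℕ)) - 1) := by
          have := Real.pi_pos
          field_simp
      _ ≤ ((n + 1 : ℕ) : ℝ)⁻¹ * (2 / ‖ζ - 1‖ - 1) := by gcongr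
      _ = ((n + 1 : ℕ) : ℝ)⁻¹ * ((2 - ‖ζ - 1‖) / ‖ζ - 1‖) := by
          rw [sub_div, div_self hpos.ne']
      _ ≤ _ := by gcongr
  rw [Fin.sum_univ_eq_sum_range fun j : ℕ => ‖⟪windowVec e s (n + 1) (ω ^ j),
    truncation e s (n + 1) (windowVec e s (n + 1) (ω ^ j))⟫_ℂ‖, Finset.sum_range_succ']
  have hlog : Real.log (n + 1 : ℕ) ≤ ∑ j ∈ Finset.range n, ((j + 1 : ℕ) : ℝ)⁻¹ := by
    have := log_add_one_le_harmonic n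
    simpa [harmonic] using this
  have h5 := Finset.sum_le_sum hterm
  rw [Finset.sum_sub_distrib, ← Finset.mul_sum, Finset.sum_const, Finset.card_range,
    nsmul_eq_mul] at h5
  have h6 : (n : ℝ) * ((n + 1 : ℕ) : ℝ)⁻¹ ≤ 1 := by
    rw [← div_eq_mul_inv, div_le_one hLpos]
    push_cast
    linarith
  have h7 : Real.log (n + 1 : ℕ) / Real.pi ≤
      Real.pi⁻¹ * ∑ j ∈ Finset.range n, ((j + 1 : ℕ) : ℝ)⁻¹ := by
    rw [div_eq_inv_mul]
    have := Real.pi_pos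
    gcongr
  -- The term `j = 0`, outside the estimate since `ζ = 1`, is only known to be nonnegative.
  have h8 := norm_nonneg ⟪windowVec e s (n + 1) (ω ^ 0),
    truncation e s (n + 1) (windowVec e s (n + 1) (ω ^ 0))⟫_ℂ
  linarith

theorem truncation_basis_of_lt {i : ℕ} (hi : i < L) :
    truncation e s L (e (s + i)) = truncCol e s L i := by
  simp only [truncation, sum_apply, rankOne_apply, inner_basis_add]
  simp [hi]

theorem truncation_basis_of_forall_ne {n : ℤ} (hn : ∀ i < L, n ≠ s + (i : ℕ)) :
    truncation e s L (e n) = 0 := by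
  rw [truncation, sum_apply]
  refine Finset.sum_eq_zero fun i hi => ?_
  rw [rankOne_apply, e.orthonormal.2 (hn i (Finset.mem_range.1 hi)).symm, zero_smul]

theorem norm_windowVec_one {L : ℕ} (hL : L ≠ 0) : ‖windowVec e s L 1‖ = 1 := by
  simpa using (orthonormal_windowVec e s hL (Complex.isPrimitiveRoot_exp L hL)).1
    ⟨0, Nat.pos_of_ne_zero hL⟩

theorem inner_windowVec_of_disjoint {s' : ℤ} {L' : ℕ} (h : s + L ≤ s') (ζ ξ : ℂ) :
    ⟪windowVec e s L ζ, windowVec e s' L' ξ⟫_ℂ = 0 := by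
  rw [windowVec, inner_smul_left, sum_inner, Finset.sum_eq_zero, mul_zero]
  intro i hi
  have := Finset.mem_range.1 hi
  rw [inner_smul_left, inner_basis_windowVec_of_lt e s' L' ξ (by lia), mul_zero]

theorem hasSum_inner_mul_truncation (X : H →L[ℂ] H) :
    HasSum (fun n => ⟪e n, (X * truncation e s L) (e n)⟫_ℂ)
      (∑ i ∈ Finset.range L, ⟪e (s + i), X (truncCol e s L i)⟫_ℂ) := by
  have h := hasSum_sum fun i (_ : i ∈ Finset.range L) =>
    hasSum_inner_mul_rankOne e X (truncCol e s L i) (e (s + i))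
  refine h.congr_fun fun n => ?_
  rw [truncation, Finset.mul_sum, sum_apply, inner_sum]

end NormedSpace

variable {H : Type*} [NormedAddCommGroup H] [InnerProductSpace ℂ H] [CompleteSpace H]

/-! ### Trace norm -/

theorem norm_abs_apply (T : H →L[ℂ] H) (x : H) : ‖CFC.abs T x‖ = ‖T x‖ := by
  have hsa : adjoint (CFC.abs T) = CFC.abs T :=
    (IsSelfAdjoint.of_nonneg (CFC.abs_nonneg T)).star_eq
  have h : CFC.abs T * CFC.abs T = star T * T := CFC.abs_mul_abs T
  have h' := congrArg (fun S : H →L[ℂ] H => ⟪S x, x⟫_ℂ) h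
  simp only [mul_apply_eq_comp, star_eq_adjoint, adjoint_inner_left] at h'
  rw [← adjoint_inner_right, hsa, inner_self_eq_norm_sq_to_K, inner_self_eq_norm_sq_to_K] at h'
  have h'' : ‖CFC.abs T x‖ ^ 2 = ‖T x‖ ^ 2 := by exact_mod_cast h'
  exact (sq_eq_sq₀ (norm_nonneg _) (norm_nonneg _)).1 h''

/-- The half of the polar decomposition needed below: `W` is the isometry `|T| x ↦ T x`, extended to
the closure of the range of `|T|` and by zero to its orthogonal complement. -/
theorem exists_eq_mul_abs (T : H →L[ℂ] H) :
    ∃ W : H →L[ℂ] H, ‖W‖ ≤ 1 ∧ T = W * CFC.abs T := by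
  set P := CFC.abs T with hP
  set K := P.range.topologicalClosure
  have : CompleteSpace K := P.range.isClosed_topologicalClosure.completeSpace_coe
  let p : H →ₗ[ℂ] K := P.toLinearMap.codRestrict K
    fun x => P.range.le_topologicalClosure ⟨x, rfl⟩
  have hp : DenseRange p := by
    intro y
    rw [closure_subtype]
    have h1 : ((↑) '' Set.range p : Set H) = (P.range : Set H) := by
      ext z
      constructor
      · rintro ⟨_, ⟨x, rfl⟩, rfl⟩
        exact ⟨x, rfl⟩
      · rintro ⟨x, rfl⟩
        exact ⟨p x, ⟨x, rfl⟩, rfl⟩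
    rw [h1]
    exact y.2
  have hn : ∀ x, ‖T.toLinearMap x‖ ≤ 1 * ‖p x‖ := by
    intro x
    rw [one_mul]
    exact (norm_abs_apply T x).ge
  let W₀ : K →L[ℂ] H := T.toLinearMap.extendOfNorm p
  refine ⟨W₀ ∘L K.orthogonalProjectionOnto, ?_, ?_⟩
  · refine (opNorm_comp_le _ _).trans ?_
    have h1 : ‖W₀‖ ≤ 1 := LinearMap.opNorm_extendOfNorm_le hp zero_le_one hn
    have h2 := K.orthogonalProjectionOnto_norm_le
    nlinarith [norm_nonneg W₀, norm_nonneg K.orthogonalProjectionOnto]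
  · ext x
    have h1 : K.orthogonalProjectionOnto (P x) = p x :=
      Submodule.orthogonalProjectionOnto_mem_subspace_eq_self (p x)
    have h2 : W₀ (p x) = T x := LinearMap.extendOfNorm_eq hp ⟨1, hn⟩ x
    simp only [mul_apply_eq_comp, comp_apply, h1, h2]

/-- The diagonal of `T` in an orthonormal family has absolute sum at most `‖T‖₁`. With `T = W R²`,
`R = |T|^{1/2}`, expand `⟪f j, T (f j)⟫` in the basis `e`; for each basis vector, Cauchy–Schwarz and
Bessel bound the sum over `j` by `‖W R (e n)‖ ‖R (e n)‖ ≤ ⟪e n, |T| (e n)⟫`. -/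
theorem sum_norm_inner_le_traceNorm {ι κ : Type*} (e : HilbertBasis ι ℂ H) (T : H →L[ℂ] H)
    {f : κ → H} (hf : Orthonormal ℂ f) (s : Finset κ) :
    ∑ j ∈ s, ENNReal.ofReal ‖⟪f j, T (f j)⟫_ℂ‖ ≤ traceNorm e T := by
  obtain ⟨W, hW, hT⟩ := exists_eq_mul_abs T
  set P := CFC.abs T with hP
  set R := CFC.sqrt P with hR
  have hRR : R * R = P := CFC.sqrt_mul_sqrt_self P (CFC.abs_nonneg T)
  have hRs : adjoint R = R := (IsSelfAdjoint.of_nonneg (CFC.sqrt_nonneg P)).star_eq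
  have hRin : ∀ x y, ⟪R x, y⟫_ℂ = ⟪x, R y⟫_ℂ := fun x y => by
    rw [← adjoint_inner_right, hRs]
  have hexp : ∀ j, HasSum (fun n => ⟪f j, W (R (e n))⟫_ℂ * ⟪R (e n), f j⟫_ℂ)
      ⟪f j, T (f j)⟫_ℂ := by
    intro j
    have h := e.hasSum_inner_mul_inner (R (adjoint W (f j))) (R (f j))
    have h1 : ⟪R (adjoint W (f j)), R (f j)⟫_ℂ = ⟪f j, T (f j)⟫_ℂ := by
      rw [hRin, adjoint_inner_left, hT, ← hRR]
      rfl
    rw [h1] at h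
    refine h.congr_fun fun n => ?_
    rw [hRin (adjoint W (f j)), adjoint_inner_left, hRin (e n)]
  have hterm : ∀ j, ENNReal.ofReal ‖⟪f j, T (f j)⟫_ℂ‖ ≤
      ∑' n, ENNReal.ofReal (‖⟪f j, W (R (e n))⟫_ℂ‖ * ‖⟪f j, R (e n)⟫_ℂ‖) := by
    intro j
    rw [← (hexp j).tsum_eq, ofReal_norm]
    refine enorm_tsum_le_tsum_enorm.trans (ENNReal.tsum_le_tsum fun n => ?_)
    rw [← ofReal_norm, norm_mul, norm_inner_symm (R (e n))]
  refine (Finset.sum_le_sum fun j _ => hterm j).trans ?_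
  rw [← Summable.tsum_finsetSum fun _ _ => ENNReal.summable]
  refine ENNReal.tsum_le_tsum fun n => ?_
  rw [← ENNReal.ofReal_sum_of_nonneg fun _ _ => by positivity]
  refine ENNReal.ofReal_le_ofReal ?_
  have h1 : RCLike.re ⟪e n, P (e n)⟫_ℂ = ‖R (e n)‖ ^ 2 := by
    rw [← hRR, mul_apply_eq_comp, ← hRin, inner_self_eq_norm_sq]
  rw [h1]
  refine (Real.sum_mul_le_sqrt_mul_sqrt _ _ _).trans ?_
  have h2 : ‖W (R (e n))‖ ≤ ‖R (e n)‖ := by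
    simpa using W.le_of_opNorm_le hW (R (e n))
  have h3 : ∀ x : H, √(∑ j ∈ s, ‖⟪f j, x⟫_ℂ‖ ^ 2) ≤ ‖x‖ := fun x =>
    (Real.sqrt_le_sqrt (hf.sum_inner_products_le x)).trans_eq (Real.sqrt_sq (norm_nonneg x))
  calc _ ≤ ‖W (R (e n))‖ * ‖R (e n)‖ := by gcongr <;> exact h3 _
    _ ≤ ‖R (e n)‖ * ‖R (e n)‖ := by gcongr
    _ = _ := by ring

theorem traceNorm_rankOne_le {ι : Type*} (e : HilbertBasis ι ℂ H) {v : H} (hv : ‖v‖ = 1) (k : ι) :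
    traceNorm e (rankOne ℂ v (e k)) ≤ 1 := by
  classical
  have hk : ‖e k‖ = 1 := e.orthonormal.1 k
  have h0 : (0 : H →L[ℂ] H) ≤ rankOne ℂ (e k) (e k) :=
    (nonneg_iff_isPositive _).2 (isPositive_rankOne_self _)
  have habs : CFC.abs (rankOne ℂ v (e k)) = rankOne ℂ (e k) (e k) := by
    refine CFC.sqrt_unique ?_ h0
    rw [star_eq_adjoint, adjoint_rankOne]
    ext x
    simp [mul_apply_eq_comp, inner_self_eq_norm_sq_to_K, hk, hv]
  rw [traceNorm, habs, tsum_eq_single k]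
  · simp [inner_self_eq_norm_sq_to_K, hk]
  · intro n hn
    simp [e.orthonormal.2 hn]

theorem isTraceClass_of_finite {ι : Type*} (e : HilbertBasis ι ℂ H) {T : H →L[ℂ] H} (s : Finset ι)
    (hT : ∀ n ∉ s, T (e n) = 0) : IsTraceClass e T := by
  rw [IsTraceClass, traceNorm, tsum_eq_sum (s := s)]
  · exact ENNReal.sum_lt_top.2 fun _ _ => ENNReal.ofReal_lt_top
  · intro n hn
    have : CFC.abs T (e n) = 0 := by
      rw [← norm_eq_zero, norm_abs_apply, hT n hn, norm_zero]
    simp [this]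

/-! ### Matrix entries and uniqueness of the representing operator -/

theorem inner_eq_zero_of_mem_bPlus {e : HilbertBasis ℤ ℂ H} {B : H →L[ℂ] H} (hB : B ∈ bPlus e)
    {m n : ℤ} (h : m < n) : ⟪e m, B (e n)⟫_ℂ = 0 := by
  have h1 : (Submodule.span ℂ (e '' Set.Ici n)).topologicalClosure ≤ (ℂ ∙ e m)ᗮ := by
    refine Submodule.topologicalClosure_minimal _ ?_ (Submodule.isClosed_orthogonal _)
    rw [Submodule.span_le]
    rintro _ ⟨l, hl, rfl⟩
    exact Submodule.mem_orthogonal_singleton_iff_inner_right.2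
      (e.orthonormal.2 (ne_of_lt (h.trans_le hl)))
  exact Submodule.mem_orthogonal_singleton_iff_inner_right.1 (h1 (hB.2 n).1)

theorem trace_rankOne_mul {ι : Type*} (e : HilbertBasis ι ℂ H) (m n : ι) (B : H →L[ℂ] H) :
    HasSum (fun l => ⟪e l, (rankOne ℂ (e m) (e n) * B) (e l)⟫_ℂ) ⟪e n, B (e m)⟫_ℂ := by
  have : rankOne ℂ (e m) (e n) * B = rankOne ℂ (e m) (adjoint B (e n)) := by
    ext x; simp [adjoint_inner_left]
  rw [this, ← adjoint_inner_left]
  exact hasSum_inner_rankOne e _ _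

/-- Injectivity of `B ↦ (X ↦ Im Tr (X B))` on `𝔟₁⁺(H)`: testing against
`|e n⟩⟨e m| - |e m⟩⟨e n|` and `i (|e n⟩⟨e m| + |e m⟩⟨e n|)` recovers the matrix entries of `B` on and
below the diagonal. -/
theorem Represents.ext {e : HilbertBasis ℤ ℂ H} {B C : H →L[ℂ] H} {φ : StrongDual ℝ (u H)}
    (hB : B ∈ bPlus e) (hC : C ∈ bPlus e) (hBφ : Represents e B φ) (hCφ : Represents e C φ) :
    B = C := by
  have key : ∀ X : u H, ∀ m n : ℤ, ∀ a b : ℂ,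
      (X : H →L[ℂ] H) = a • rankOne ℂ (e m) (e n) + b • rankOne ℂ (e n) (e m) →
      (a * ⟪e n, B (e m)⟫_ℂ + b * ⟪e m, B (e n)⟫_ℂ).im =
        (a * ⟪e n, C (e m)⟫_ℂ + b * ⟪e m, C (e n)⟫_ℂ).im := by
    intro X m n a b hX
    have htr : ∀ D : H →L[ℂ] H, trace e ((X : H →L[ℂ] H) * D) =
        a * ⟪e n, D (e m)⟫_ℂ + b * ⟪e m, D (e n)⟫_ℂ := by
      intro D
      rw [trace, ← (((trace_rankOne_mul e m n D).mul_left a).add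
        ((trace_rankOne_mul e n m D).mul_left b)).tsum_eq, hX]
      congr 1
      ext l
      simp [add_mul]
    rw [← htr, ← htr, ← hBφ, ← hCφ]
  have hre : ∀ m n : ℤ, ⟪e m, B (e n)⟫_ℂ = ⟪e m, C (e n)⟫_ℂ := by
    intro m n
    have hskew : (Complex.I • rankOne ℂ (e n) (e m) + Complex.I • rankOne ℂ (e m) (e n) :
        H →L[ℂ] H) ∈ u H := by
      refine skewAdjoint.mem_iff.2 ?_
      simp [star_eq_adjoint, add_comm]
    have k1 := key ⟨_, hskew⟩ n m Complex.I Complex.I rfl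
    rcases lt_trichotomy m n with h | rfl | h
    · rw [inner_eq_zero_of_mem_bPlus hB h, inner_eq_zero_of_mem_bPlus hC h]
    · apply Complex.ext
      · simp at k1
        linarith
      · rw [(hB.2 m).2, (hC.2 m).2]
    · have hskew' : ((1 : ℂ) • rankOne ℂ (e n) (e m) + (-1 : ℂ) • rankOne ℂ (e m) (e n) :
          H →L[ℂ] H) ∈ u H := by
        refine skewAdjoint.mem_iff.2 ?_
        simp [star_eq_adjoint]
      have k2 := key ⟨_, hskew'⟩ n m 1 (-1) rfl
      rw [inner_eq_zero_of_mem_bPlus hB h, inner_eq_zero_of_mem_bPlus hC h] at k1 k2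
      apply Complex.ext
      · simpa using k1
      · simpa using k2
  have hvec : ∀ n, B (e n) = C (e n) := fun n => e.repr.injective <| by
    ext m
    simpa [e.repr_apply_apply] using hre m n
  refine ContinuousLinearMap.ext_on (s := Set.range e) ?_ ?_
  · rw [Submodule.dense_iff_topologicalClosure_eq_top]
    exact e.dense_span
  · rintro _ ⟨n, rfl⟩
    exact hvec n

theorem imageNorm_eq {e : HilbertBasis ℤ ℂ H} {B : H →L[ℂ] H} {φ : StrongDual ℝ (u H)}
    (hB : B ∈ bPlus e) (h : Represents e B φ) : imageNorm e φ = traceNorm e B := by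
  refine le_antisymm (iInf₂_le B ⟨hB, h⟩) (le_iInf₂ fun C hC => ?_)
  rw [Represents.ext hB hC.1 h hC.2]

/-! ### A skew-Hermitian operator exchanging two orthonormal sequences -/

/-- Two mutually orthogonal orthonormal sequences `x`, `y` are exchanged, up to sign, by a bounded
skew-Hermitian operator. -/
theorem exists_skew {x y : ℕ → H} (hx : Orthonormal ℂ x) (hy : Orthonormal ℂ y)
    (hxy : ∀ i j, ⟪x i, y j⟫_ℂ = 0) :
    ∃ A : u H, ∀ i, (A : H →L[ℂ] H) (x i) = y i ∧ (A : H →L[ℂ] H) (y i) = -x i := by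
  have iso : ∀ {z : ℕ → H}, Orthonormal ℂ z →
      ∃ U : lp (fun _ : ℕ => ℂ) 2 →ₗᵢ[ℂ] H, ∀ i, U (lp.single 2 i 1) = z i := by
    intro z hz
    refine ⟨hz.orthogonalFamily.linearIsometry, fun i => ?_⟩
    rw [OrthogonalFamily.linearIsometry_apply_single]
    simp
  obtain ⟨U, hU⟩ := iso hx
  obtain ⟨V, hV⟩ := iso hy
  have self : ∀ (W : lp (fun _ : ℕ => ℂ) 2 →ₗᵢ[ℂ] H) (f : lp (fun _ : ℕ => ℂ) 2),
      adjoint W.toContinuousLinearMap (W f) = f := by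
    intro W f
    refine ext_inner_right ℂ fun g => ?_
    rw [adjoint_inner_left]
    exact W.inner_map_map f g
  have cross : ∀ (W : lp (fun _ : ℕ => ℂ) 2 →ₗᵢ[ℂ] H) (v : H),
      (∀ i, ⟪W (lp.single 2 i 1), v⟫_ℂ = 0) → adjoint W.toContinuousLinearMap v = 0 := by
    intro W v h
    ext i
    have h1 := h i
    have h2 : W (lp.single 2 i 1) = W.toContinuousLinearMap (lp.single 2 i 1) := rfl
    rw [h2, ← adjoint_inner_right, lp.inner_single_left] at h1
    simpa using h1
  have hyx : ∀ i j, ⟪y i, x j⟫_ℂ = 0 := fun i j => inner_eq_zero_symm.1 (hxy j i)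
  refine ⟨⟨V.toContinuousLinearMap ∘L adjoint U.toContinuousLinearMap -
    U.toContinuousLinearMap ∘L adjoint V.toContinuousLinearMap, ?_⟩, fun i => ⟨?_, ?_⟩⟩
  · refine skewAdjoint.mem_iff.2 ?_
    simp [star_eq_adjoint, adjoint_comp]
  · have h1 : adjoint U.toContinuousLinearMap (x i) = lp.single 2 i 1 := by rw [← hU, self]
    have h2 : adjoint V.toContinuousLinearMap (x i) = 0 :=
      cross V _ fun j => by rw [hV, hyx]
    simp [h1, h2, hV]
  · have h1 : adjoint V.toContinuousLinearMap (y i) = lp.single 2 i 1 := by rw [← hV, self]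
    have h2 : adjoint U.toContinuousLinearMap (y i) = 0 :=
      cross U _ fun j => by rw [hU, hxy]
    simp [h1, h2, hU]

/-! ### The coadjoint action on functionals of rank-one operators -/

/-- The functional `X ↦ Im ⟪x, X y⟫` on `𝔲(H)`. -/
def imInner (x y : H) : StrongDual ℝ (u H) :=
  Complex.imCLM ∘L ((innerSL ℂ x ∘L ContinuousLinearMap.apply ℂ H y).restrictScalars ℝ) ∘L
    (u H).subtypeL

theorem imInner_apply (x y : H) (X : u H) : imInner x y X = (⟪x, (X : H →L[ℂ] H) y⟫_ℂ).im := rfl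

theorem inner_skew_left (X : u H) (x y : H) :
    ⟪(X : H →L[ℂ] H) x, y⟫_ℂ = -⟪x, (X : H →L[ℂ] H) y⟫_ℂ := by
  have h : adjoint (X : H →L[ℂ] H) = -X := skewAdjoint.mem_iff.1 X.2
  rw [← adjoint_inner_right, h, neg_apply, inner_neg_right]

theorem im_inner_skew_comm (X : u H) (x y : H) :
    (⟪x, (X : H →L[ℂ] H) y⟫_ℂ).im = (⟪y, (X : H →L[ℂ] H) x⟫_ℂ).im := by
  rw [← inner_conj_symm, inner_skew_left, map_neg, Complex.neg_im, Complex.conj_im, neg_neg]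

theorem represents_rankOne (e : HilbertBasis ℤ ℂ H) (v w : H) :
    Represents e (rankOne ℂ v w) (imInner w v) := fun X => by
  rw [trace, (hasSum_inner_mul_rankOne e X v w).tsum_eq, imInner_apply]

/-- The summability hypotheses are needed because `trace` is a `tsum`, which is not additive in
general. -/
theorem Represents.sub_of_summable {e : HilbertBasis ℤ ℂ H} {B C : H →L[ℂ] H}
    {φ ψ : StrongDual ℝ (u H)} (hB : Represents e B φ) (hC : Represents e C ψ)
    (hBs : ∀ X : H →L[ℂ] H, Summable fun n => ⟪e n, (X * B) (e n)⟫_ℂ)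
    (hCs : ∀ X : H →L[ℂ] H, Summable fun n => ⟪e n, (X * C) (e n)⟫_ℂ) :
    Represents e (B - C) (φ - ψ) := fun X => by
  rw [sub_apply, hB, hC, ← Complex.sub_im, trace, trace, trace, ← (hBs X).tsum_sub (hCs X)]
  simp [mul_sub]

/-- Applied to the representative `|y⟩⟨x|` of `imInner x y`, the coadjoint action of `A` produces the
functional of the commutator `|x⟩⟨x| - |y⟩⟨y|`. -/
theorem coad_imInner {A : u H} {x y : H} (hx : (A : H →L[ℂ] H) x = y)
    (hy : (A : H →L[ℂ] H) y = -x) :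
    coad A (imInner x y) = imInner x x - imInner y y := by
  ext X
  have h := inner_skew_left A x ((X : H →L[ℂ] H) y)
  rw [hx] at h
  simp [coad, imInner_apply, hy, h]
  ring

theorem sum_range_sum_range_of_symm {t : ℕ → ℕ → ℝ} (ht : ∀ i l, t i l = t l i) (L : ℕ) :
    ∑ i ∈ Finset.range L, ∑ l ∈ Finset.range L, t i l =
      ∑ i ∈ Finset.range L, (t i i + 2 * ∑ l ∈ Finset.Ico (i + 1) L, t i l) := by
  induction L with
  | zero => simp
  | succ L ih =>
    have h : ∀ i ∈ Finset.range L, t i i + 2 * ∑ l ∈ Finset.Ico (i + 1) (L + 1), t i l =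
        (t i i + 2 * ∑ l ∈ Finset.Ico (i + 1) L, t i l) + 2 * t i L := fun i hi => by
      rw [Finset.sum_Ico_succ_top (Finset.mem_range.1 hi)]
      ring
    have h' : ∑ i ∈ Finset.range L, t L i = ∑ i ∈ Finset.range L, t i L :=
      Finset.sum_congr rfl fun i _ => ht L i
    rw [Finset.sum_range_succ, Finset.sum_range_succ (n := L)
      (f := fun i => t i i + 2 * ∑ l ∈ Finset.Ico (i + 1) (L + 1), t i l),
      Finset.sum_congr rfl h, Finset.sum_add_distrib, ← ih, ← Finset.mul_sum, Finset.Ico_self, Finset.sum_empty,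
      Finset.sum_range_succ _ L, h']
    simp only [Finset.sum_range_succ, Finset.sum_add_distrib]
    ring

variable (e : HilbertBasis ℤ ℂ H) (s : ℤ) (L : ℕ)

/-- `|a⟩⟨a|` with `a = windowVec e s L 1` and its triangular truncation define the same functional,
because `Im ⟪x, X y⟫` is symmetric in `x` and `y` for skew-Hermitian `X`. -/
theorem represents_truncation :
    Represents e (truncation e s L) (imInner (windowVec e s L 1) (windowVec e s L 1)) := fun X => by
  have ht := sum_range_sum_range_of_symm
    (fun i l : ℕ => im_inner_skew_comm X (e (s + i)) (e (s + l))) L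
  have hc : ∀ z : ℂ, ((L : ℂ)⁻¹ * z).im = (L : ℝ)⁻¹ * z.im := fun z => by
    rw [← Complex.im_ofReal_mul]
    simp
  rw [trace, (hasSum_inner_mul_truncation e s L X).tsum_eq, imInner_apply]
  have h1 : ⟪windowVec e s L 1, (X : H →L[ℂ] H) (windowVec e s L 1)⟫_ℂ = (L : ℂ)⁻¹ *
      ∑ i ∈ Finset.range L, ∑ l ∈ Finset.range L, ⟪e (s + i), (X : H →L[ℂ] H) (e (s + l))⟫_ℂ := by
    simp only [windowVec, one_pow, one_smul, map_smul, map_sum, inner_smul_left, inner_smul_right,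
      inner_sum, sum_inner]
    rw [Finset.sum_comm, ← inv_sqrt_mul_inv_sqrt]
    simp [mul_assoc, Finset.mul_sum]
  rw [h1, hc, Complex.im_sum, Complex.im_sum]
  simp only [Complex.im_sum]
  rw [ht, Finset.mul_sum]
  refine Finset.sum_congr rfl fun i _ => ?_
  rw [truncCol, map_smul, inner_smul_right, hc]
  simp [inner_add_right, inner_smul_right, inner_sum]

/-! ### Membership in `𝔟₁⁺(H)` and the lower bound -/

theorem rankOne_sub_truncation_mem_bPlus {k : ℤ} (hk : k < s) :
    rankOne ℂ (e k) (e k) - truncation e s L ∈ bPlus e := by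
  have hbasis : ∀ n : ℤ, n = k ∨ (∃ i < L, n = s + (i : ℕ)) ∨
      (n ≠ k ∧ ∀ i < L, n ≠ s + (i : ℕ)) := fun n => by
    by_cases h : n = k
    · exact Or.inl h
    · by_cases h' : ∃ i < L, n = s + (i : ℕ)
      · exact Or.inr (Or.inl h')
      · push Not at h'
        exact Or.inr (Or.inr ⟨h, h'⟩)
  have hmem : ∀ {m n : ℤ}, n ≤ m →
      e m ∈ (Submodule.span ℂ (e '' Set.Ici n)).topologicalClosure := fun h =>
    Submodule.le_topologicalClosure _ (Submodule.subset_span ⟨_, h, rfl⟩)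
  refine ⟨isTraceClass_of_finite e (insert k ((Finset.range L).image fun i : ℕ => s + (i : ℤ))) ?_,
    fun n => ?_⟩
  · intro n hn
    rw [Finset.mem_insert, Finset.mem_image] at hn
    push Not at hn
    rw [sub_apply, rankOne_apply, e.orthonormal.2 hn.1.symm, zero_smul,
      truncation_basis_of_forall_ne e s L fun i hi => (hn.2 i (Finset.mem_range.2 hi)).symm,
      sub_zero]
  · rcases hbasis n with rfl | ⟨i, hi, rfl⟩ | ⟨h1, h2⟩
    · have : (rankOne ℂ (e n) (e n) - truncation e s L) (e n) = e n := by
        rw [sub_apply, truncation_basis_of_forall_ne e s L fun i _ => by lia, rankOne_apply,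
          inner_self_eq_norm_sq_to_K, e.orthonormal.1]
        simp
      rw [this]
      refine ⟨hmem le_rfl, ?_⟩
      rw [inner_self_eq_norm_sq_to_K, e.orthonormal.1]
      simp
    · have : (rankOne ℂ (e k) (e k) - truncation e s L) (e (s + i)) = -truncCol e s L i := by
        rw [sub_apply, truncation_basis_of_lt e s L hi, rankOne_apply,
          e.orthonormal.2 (by lia), zero_smul, zero_sub]
      rw [this]
      constructor
      · refine Submodule.neg_mem _ (Submodule.smul_mem _ _ (Submodule.add_mem _ (hmem le_rfl)
          (Submodule.smul_mem _ _ (Submodule.sum_mem _ fun l hl => hmem ?_))))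
        have := (Finset.mem_Ico.1 hl).1
        lia
      · rw [truncCol]
        simp [inner_smul_right, inner_sum, inner_basis_add, inner_self_eq_norm_sq_to_K,
          e.orthonormal.1]
    · have : (rankOne ℂ (e k) (e k) - truncation e s L) (e n) = 0 := by
        rw [sub_apply, truncation_basis_of_forall_ne e s L h2, rankOne_apply,
          e.orthonormal.2 h1.symm, zero_smul, zero_sub, neg_zero]
      rw [this]
      simp

theorem log_le_traceNorm_rankOne_sub_truncation (hL : L ≠ 0) {k : ℤ} (hk : k < s) :
    ENNReal.ofReal (Real.log L / Real.pi - 1) ≤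
      traceNorm e (rankOne ℂ (e k) (e k) - truncation e s L) := by
  refine (ENNReal.ofReal_le_ofReal (log_le_sum_norm_inner_truncation e s hL)).trans ?_
  rw [ENNReal.ofReal_sum_of_nonneg fun _ _ => norm_nonneg _]
  refine le_trans (le_of_eq (Finset.sum_congr rfl fun j _ => ?_))
    (sum_norm_inner_le_traceNorm e _
      (orthonormal_windowVec e s hL (Complex.isPrimitiveRoot_exp L hL)) Finset.univ)
  rw [sub_apply, rankOne_apply, inner_basis_windowVec_of_lt e s L _ hk, zero_smul, zero_sub,
    inner_neg_right, norm_neg]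

theorem rankOne_windowVec_mem_bPlus {L : ℕ} (hL : L ≠ 0) {k : ℤ} (hk : k < s) :
    rankOne ℂ (windowVec e s L 1) (e k) ∈ bPlus e := by
  refine ⟨(traceNorm_rankOne_le e (norm_windowVec_one e s hL) k).trans_lt ENNReal.one_lt_top,
    fun n => ?_⟩
  rw [rankOne_apply]
  by_cases hn : k = n
  · subst hn
    constructor
    · refine Submodule.smul_mem _ _ (Submodule.le_topologicalClosure _ (Submodule.smul_mem _ _
        (Submodule.sum_mem _ fun i _ => Submodule.smul_mem _ _
          (Submodule.subset_span ⟨s + i, ?_, rfl⟩))))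
      rw [Set.mem_Ici]
      lia
    · rw [inner_smul_right, inner_basis_windowVec_of_lt e s L 1 hk]
      simp
  · rw [e.orthonormal.2 hn, zero_smul]
    simp

end UnitaryCoadjoint

end

open UnitaryCoadjoint in
theorem theorem3p2 {H : Type*} [NormedAddCommGroup H] [InnerProductSpace ℂ H] [CompleteSpace H]
    (e : HilbertBasis ℤ ℂ H) :
    ∃ A : UnitaryCoadjoint.u H, ∀ M : ℝ≥0, ∃ φ ∈ UnitaryCoadjoint.bPlusImage e,
      UnitaryCoadjoint.coad A φ ∈ UnitaryCoadjoint.bPlusImage e ∧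
      UnitaryCoadjoint.imageNorm e φ ≤ 1 ∧
      (M : ℝ≥0∞) < UnitaryCoadjoint.imageNorm e (UnitaryCoadjoint.coad A φ) := by
  let x : ℕ → H := fun N => e (-(N + 1 : ℤ))
  let y : ℕ → H := fun N => windowVec e (2 ^ N) (2 ^ N) 1
  have hneg : ∀ M N : ℕ, -(M + 1 : ℤ) < 2 ^ N := fun M N => by
    have : (0 : ℤ) < 2 ^ N := by positivity
    lia
  have hx : Orthonormal ℂ x := e.orthonormal.comp _ fun M N h => by
    have : -(M + 1 : ℤ) = -(N + 1 : ℤ) := h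
    lia
  have hy : Orthonormal ℂ y := by
    have hlt : ∀ M N : ℕ, M < N → ⟪y M, y N⟫_ℂ = 0 := fun M N h => by
      refine inner_windowVec_of_disjoint e _ _ ?_ 1 1
      -- The window of `y M` ends before `2 ^ (M + 1)`, and that of `y N` starts at `2 ^ N`.
      have h1 : (2 : ℤ) ^ (M + 1) ≤ 2 ^ N := pow_le_pow_right₀ (by norm_num) h
      push_cast
      rw [pow_succ] at h1
      lia
    refine ⟨fun N => norm_windowVec_one e _ (by positivity), fun M N h => ?_⟩
    rcases lt_or_gt_of_ne h with h | h
    · exact hlt M N h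
    · exact inner_eq_zero_symm.1 (hlt N M h)
  obtain ⟨A, hA⟩ := exists_skew hx hy fun M N => inner_basis_windowVec_of_lt e _ _ 1 (hneg M N)
  refine ⟨A, fun M => ?_⟩
  -- `N log 2 / π - 1 > M` makes the lower bound for the trace norm exceed `M`.
  obtain ⟨N, hN⟩ := exists_nat_gt (((M : ℝ) + 1) * Real.pi / Real.log 2)
  have hL : (2 ^ N : ℕ) ≠ 0 := by positivity
  have hlog : (M : ℝ) < Real.log (2 ^ N : ℕ) / Real.pi - 1 := by
    have h2 := Real.log_pos one_lt_two
    rw [div_lt_iff₀ h2] at hN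
    rw [lt_sub_iff_add_lt, lt_div_iff₀ Real.pi_pos]
    push_cast
    rwa [Real.log_pow]
  have hB := rankOne_windowVec_mem_bPlus e (2 ^ N) hL (hneg N N)
  have hBφ := represents_rankOne e (y N) (x N)
  have hC := rankOne_sub_truncation_mem_bPlus e (2 ^ N) (2 ^ N) (hneg N N)
  have hCφ : Represents e (rankOne ℂ (x N) (x N) - truncation e (2 ^ N) (2 ^ N))
      (coad A (imInner (x N) (y N))) := by
    rw [coad_imInner (hA N).1 (hA N).2]
    exact (represents_rankOne e _ _).sub_of_summable (represents_truncation e _ _)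
      (fun X => (hasSum_inner_mul_rankOne e X _ _).summable)
      (fun X => (hasSum_inner_mul_truncation e _ _ X).summable)
  refine ⟨imInner (x N) (y N), ⟨_, hB, hBφ⟩, ⟨_, hC, hCφ⟩, ?_, ?_⟩
  · rw [imageNorm_eq hB hBφ]
    exact traceNorm_rankOne_le e (norm_windowVec_one e _ hL) _
  · rw [imageNorm_eq hC hCφ]
    refine lt_of_lt_of_le ?_ (log_le_traceNorm_rankOne_sub_truncation e _ _ hL (hneg N N))
    rw [← ENNReal.ofReal_coe_nnreal]
    exact (ENNReal.ofReal_lt_ofReal_iff_of_nonneg M.2).2 hlog
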